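/- Let $(R,\mathfrak m)$ be a $d$-dimensional Cohen–Macaulay (Noetherian) local ring with $d\ge 2$, and let $I$ be a parameter ideal, i.e. an ideal generated by a system of parameters. Put $H(n)=\ell_R(R/I^n)$ for $n\in\mathbb Z$, where $I^n=R$ for $n\le 0$. Then all $H(n)$ are finite, and there is a unique polynomial $P_I\in\mathbb Q[x]$ with $H(n)=P_I(n)$ for all large $n$; it has degree $d$. Let $e_0(I)$ be the multiplicity of $I$, that is, $d!$ times the leading coefficient of $P_I$. For generators $x_1,\dots,x_d$ of $I$ and $s\in\mathbb N$ put $I^{[s]}=(x_1^s,\dots,x_d^s)$ and $F(s,n)=\ell_R\big(I^{[s]}/I^{[s]}I^n\big)$. Then $F(s,n)$ is finite and, for every fixed $s\in\mathbb N$, \[ F(s,n)=\begin{cases} d\,H(n) & \text{if } 1\le n\le s,\\[2pt] \displaystyle\sum_{i=1}^{d-1}(-1)^{i+1}\binom{d}{i}\,H\big(n-(i-1)s\big) & \text{if } s+1\le n\le (d-1)s-1,\\[2pt] H(n+s)-s^d e_0(I) & \text{if } n\ge (d-1)s.\end{cases} \] In particular, the function $F(s,n)$ does not depend on the choice of the generating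 set $\{x_1,\dots,x_d\}$ of $I$ with $d$ elements. -/

import Mathlib

open Polynomial

namespace HilbertKunz

/-- The depth of a local ring: the supremum of the lengths of the `R`-regular sequences
contained in the maximal ideal. -/
noncomputable def localDepth (R : Type*) [CommRing R] [IsLocalRing R] : ℕ∞ :=
  ⨆ (rs : List R) (_ : (∀ r ∈ rs, r ∈ IsLocalRing.maximalIdeal R) ∧
    RingTheory.Sequence.IsRegular R rs), (rs.length : ℕ∞)

/-- A local ring is Cohen-Macaulay if it is Noetherian and its depth equals its Krull dimension. -/
structure IsCohenMacaulayLocal (R : Type*) [CommRing R] [IsLocalRing R] : Prop where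
  isNoetherianRing : IsNoetherianRing R
  depth_eq_dim : (localDepth R : WithBot ℕ∞) = ringKrullDim R

/-- `x₁, …, x_d` is a system of parameters: `d = dim R` and `(x₁, …, x_d)` is primary to the
maximal ideal. -/
def IsSystemOfParameters {R : Type*} [CommRing R] [IsLocalRing R] {d : ℕ} (x : Fin d → R) : Prop :=
  ringKrullDim R = d ∧ (Ideal.span (Set.range x)).radical = IsLocalRing.maximalIdeal R

/-- A parameter ideal is an ideal generated by a system of parameters. -/
def IsParameterIdeal {R : Type*} [CommRing R] [IsLocalRing R] (I : Ideal R) : Prop :=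
  ∃ (d : ℕ) (x : Fin d → R), IsSystemOfParameters x ∧ Ideal.span (Set.range x) = I

section Lengths

variable {R : Type*} [CommRing R]

/-- The length of `R / I ^ n` over `R`, where `I ^ n = R` for `n ≤ 0`. -/
noncomputable def lengthPow (I : Ideal R) (n : ℤ) : ℕ∞ :=
  Module.length R (R ⧸ I ^ n.toNat)

/-- The Hilbert-Samuel function `H(n) = ℓ(R / I ^ n)`, as a number. -/
noncomputable def H (I : Ideal R) (n : ℤ) : ℚ :=
  ((lengthPow I n).toNat : ℚ)

/-- The ideal `I^{[s]} = (x₁ ^ s, …, x_d ^ s)` attached to the generators `x₁, …, x_d`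
of an ideal `I`. -/
def bracketPower {d : ℕ} (x : Fin d → R) (s : ℕ) : Ideal R :=
  Ideal.span (Set.range fun i => x i ^ s)

/-- The length of `I^{[s]} / I^{[s]} I ^ n` over `R`, where `I = (x₁, …, x_d)` and `I^{[s]}` is
formed with the generators `x₁, …, x_d`. -/
noncomputable def lengthBracket {d : ℕ} (x : Fin d → R) (s n : ℕ) : ℕ∞ :=
  Module.length R (bracketPower x s ⧸
    (bracketPower x s * Ideal.span (Set.range x) ^ n).submoduleOf (bracketPower x s))

/-- The function `F(s, n) = ℓ(I^{[s]} / I^{[s]} I ^ n)`, as a number. -/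
noncomputable def F {d : ℕ} (x : Fin d → R) (s n : ℕ) : ℚ :=
  ((lengthBracket x s n).toNat : ℚ)

/-- `P` is a Hilbert-Samuel polynomial of `I`: `ℓ(R / I ^ n)` is finite and equal to `P(n)` for
all large `n`. There is at most one such `P`. -/
def IsHilbertPolynomial (I : Ideal R) (P : ℚ[X]) : Prop :=
  ∀ᶠ n : ℕ in Filter.atTop, lengthPow I n ≠ ⊤ ∧ H I n = P.eval (n : ℚ)

open Classical in
/-- The Hilbert-Samuel polynomial `P_I` of `I` (and `0` if `I` has none). -/
noncomputable def hilbertPolynomial (I : Ideal R) : ℚ[X] :=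
  if h : ∃ P : ℚ[X], IsHilbertPolynomial I P then h.choose else 0

/-- The multiplicity `e₀(I)` of an ideal `I` of a `d`-dimensional local ring, that is, the
coefficient of `binom (x + d - 1) d` in
`P_I = e₀ * binom (x + d - 1) d - e₁ * binom (x + d - 2) (d - 1) + ⋯`; as `P_I` has degree `d`,
this is `d !` times the coefficient of `x ^ d`. -/
noncomputable def e₀ (d : ℕ) (I : Ideal R) : ℚ :=
  (d.factorial : ℚ) * (hilbertPolynomial I).coeff d

end Lengths

end HilbertKunz

/-! In a Cohen–Macaulay local ring every system of parameters is a regular sequence in any order, so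
colengths of ideals generated by monomials in `x` can be counted as if the `x i` were variables. If
`A` is an up-closed set of exponents with finite complement and `e = ℓ(R/I)`, the ideal of the
monomials in `A` has colength `e` times the size of the complement
(`length_quotient_monomialIdeal`). Both `I ^ n` and `I^{[s]} I ^ n` are of this kind. Hence `H(n)`
is `e` times the number of `a` with `|a| < n`, and `F(s, n)` is `e` times the number of `a` with
`|a| < s + n` and some `a i ≥ s` (`lengthBracket_eq`). As `e` depends only on `I`, so does `F`. What
is left is a lattice point count. Inclusion–exclusion over the coordinates that are at least `s`,
with a translation in each term, gives `∑ (-1)^(m+1) binom(d, m) H(n - (m-1)s)` for `1 ≤ m ≤ d`. The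
first two cases only record which terms vanish; in the third the excluded points form the full box
of `s ^ d` points, and `e₀ = e`. Regularity of parameters (`isWeaklyRegular_of_forall_isPrime`)
rests on two facts about depth: it drops by at most one modulo a regular element, and it is bounded
by `dim R/p` for associated primes `p`. -/

namespace HilbertKunz

/-! ### Depth, and regularity of systems of parameters -/

section Depth

open IsLocalRing RingTheory.Sequence

open scoped Pointwise

universe u v

variable {R : Type u} [CommRing R] [IsLocalRing R]

/-- The socles of `M / yM` and `M / zM` vanish simultaneously, for `M`-regular `y` and `z`. -/
lemma socle_quotSMulTop_eq_bot {M : Type*} [AddCommGroup M] [Module R M] {y z : R}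
    (hym : y ∈ maximalIdeal R) (hy : IsSMulRegular M y) (hz : IsSMulRegular M z)
    (h : ∀ u : QuotSMulTop y M, (∀ r ∈ maximalIdeal R, r • u = 0) → u = 0) :
    ∀ u : QuotSMulTop z M, (∀ r ∈ maximalIdeal R, r • u = 0) → u = 0 := by
  intro u hu
  obtain ⟨u, rfl⟩ := Submodule.Quotient.mk_surjective _ u
  have mem : ∀ r ∈ maximalIdeal R, ∃ v : M, r • u = z • v := by
    intro r hr
    have := hu r hr
    rw [← Submodule.Quotient.mk_smul, Submodule.Quotient.mk_eq_zero,
      Submodule.mem_smul_pointwise_iff_exists] at this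
    obtain ⟨v, -, hv⟩ := this
    exact ⟨v, hv.symm⟩
  -- The class of `v`, defined by `y u = z v`, realizes the isomorphism of socles that comes from
  -- identifying both with `Ext¹(k, M)`.
  obtain ⟨v, hv⟩ := mem y hym
  have hv0 : (Submodule.Quotient.mk v : QuotSMulTop y M) = 0 := by
    refine h _ fun r hr => ?_
    obtain ⟨v', hv'⟩ := mem r hr
    have : r • v = y • v' := hz (by
      change z • r • v = z • y • v'
      rw [smul_comm z r, ← hv, smul_comm r y, hv', smul_comm])
    rw [← Submodule.Quotient.mk_smul, Submodule.Quotient.mk_eq_zero, this]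
    exact Submodule.smul_mem_pointwise_smul _ _ _ trivial
  rw [Submodule.Quotient.mk_eq_zero, Submodule.mem_smul_pointwise_iff_exists] at hv0
  obtain ⟨v', -, rfl⟩ := hv0
  have : u = z • v' := hy (by
    change y • u = y • z • v'
    rw [hv, smul_comm])
  rw [this, Submodule.Quotient.mk_eq_zero]
  exact Submodule.smul_mem_pointwise_smul _ _ _ trivial

variable [IsNoetherianRing R]

lemma not_maximalIdeal_le_of_mem_associatedPrimes {L : Type*} [AddCommGroup L] [Module R L]
    (hL : ∀ u : L, (∀ r ∈ maximalIdeal R, r • u = 0) → u = 0) :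
    ∀ p ∈ associatedPrimes R L, ¬ maximalIdeal R ≤ p := by
  intro p hp hle
  obtain ⟨hp1, u, rfl⟩ := isAssociatedPrime_iff.mp hp
  have hu : u = 0 := hL u fun r hr => by
    simpa [Submodule.mem_colon_singleton] using hle hr
  exact hp1.ne_top (by simp [hu])

/-- Prime avoidance: a vanishing socle means that the maximal ideal is not associated, so it is not
covered by the finitely many associated primes of the two modules. -/
lemma exists_isSMulRegular_of_socle_eq_bot {M N : Type*} [AddCommGroup M] [Module R M]
    [Module.Finite R M] [AddCommGroup N] [Module R N] [Module.Finite R N]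
    (hM : ∀ u : M, (∀ r ∈ maximalIdeal R, r • u = 0) → u = 0)
    (hN : ∀ u : N, (∀ r ∈ maximalIdeal R, r • u = 0) → u = 0) :
    ∃ w ∈ maximalIdeal R, IsSMulRegular M w ∧ IsSMulRegular N w := by
  by_contra! h
  have hsub : ((maximalIdeal R : Ideal R) : Set R) ⊆
      ⋃ p ∈ associatedPrimes R M ∪ associatedPrimes R N, ((id p : Ideal R) : Set R) := by
    intro w hw
    rw [Set.biUnion_union]
    simp only [id]
    rw [biUnion_associatedPrimes_eq_compl_regular R, biUnion_associatedPrimes_eq_compl_regular R]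
    by_cases hw1 : IsSMulRegular M w
    · exact Or.inr (h w hw hw1)
    · exact Or.inl hw1
  obtain ⟨p, hp, hle⟩ := (Ideal.subset_union_prime_finite
    ((associatedPrimes.finite R M).union (associatedPrimes.finite R N)) ⊥ ⊥
    (fun p hp _ _ => by
      rcases hp with hp | hp
      · exact hp.isPrime
      · exact hp.isPrime)).mp hsub
  rcases hp with hp | hp
  · exact not_maximalIdeal_le_of_mem_associatedPrimes hM p hp hle
  · exact not_maximalIdeal_le_of_mem_associatedPrimes hN p hp hle

/-- Going modulo a regular element lowers the depth by at most one. -/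
lemma exists_isWeaklyRegular_quotSMulTop (n : ℕ) : ∀ (M : Type v) [AddCommGroup M] [Module R M]
    [Module.Finite R M] (rs : List R) (z : R), rs.length = n + 1 →
    (∀ r ∈ rs, r ∈ maximalIdeal R) → IsWeaklyRegular M rs → z ∈ maximalIdeal R →
    IsSMulRegular M z →
    ∃ rs' : List R, rs'.length = n ∧ (∀ r ∈ rs', r ∈ maximalIdeal R) ∧
      IsWeaklyRegular (QuotSMulTop z M) rs' := by
  induction n with
  | zero => exact fun M _ _ _ _ _ _ _ _ _ _ => ⟨[], rfl, by simp, .nil R _⟩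
  | succ n ih =>
    intro M _ _ _ rs z hlen hrs hreg hzm hz
    obtain ⟨y, y', rs, rfl⟩ : ∃ y y' rs', rs = y :: y' :: rs' := by
      match rs, hlen with
      | y :: y' :: rs', _ => exact ⟨y, y', rs', rfl⟩
    obtain ⟨hy, hreg'⟩ := (isWeaklyRegular_cons_iff _ _ _).mp hreg
    have hym : y ∈ maximalIdeal R := hrs y (by simp)
    have hsoc : ∀ u : QuotSMulTop y M, (∀ r ∈ maximalIdeal R, r • u = 0) → u = 0 := by
      intro u hu
      have h1 := ((isWeaklyRegular_cons_iff _ _ _).mp hreg').1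
      exact h1 (by simpa using hu y' (hrs y' (by simp)))
    -- `w` mediates between `y` and `z`, since `(y, w)` and `(z, w)` are both regular. The induction
    -- hypothesis is used over `M / yM` to trade `y'` for `w`, then over `M / wM` to trade `y` for
    -- `z`; permutability of regular sequences does the rest.
    obtain ⟨w, hwm, hwy, hwz⟩ := exists_isSMulRegular_of_socle_eq_bot hsoc
      (socle_quotSMulTop_eq_bot hym hy hz hsoc)
    have hzw : IsWeaklyRegular M [w, z] := by
      refine IsLocalRing.isWeaklyRegular_of_perm_of_subset_maximalIdeal
        (rs := [z, w]) ?_ (.swap _ _ _) (by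
          simp only [List.mem_cons, List.not_mem_nil, or_false, forall_eq_or_imp, forall_eq]
          exact ⟨hzm, hwm⟩)
      rw [isWeaklyRegular_cons_iff, isWeaklyRegular_singleton_iff]
      exact ⟨hz, hwz⟩
    obtain ⟨hw, hz'⟩ := (isWeaklyRegular_cons_iff _ _ _).mp hzw
    rw [isWeaklyRegular_singleton_iff] at hz'
    obtain ⟨s, hs, hsm, hsreg⟩ := ih (QuotSMulTop y M) (y' :: rs) w (by simpa using hlen)
      (fun r hr => hrs r (by simp_all)) hreg' hwm hwy
    have hwys : IsWeaklyRegular M (w :: y :: s) := by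
      refine IsLocalRing.isWeaklyRegular_of_perm_of_subset_maximalIdeal
        (rs := y :: w :: s) ?_ (.swap _ _ _) (by
          simp only [List.mem_cons, forall_eq_or_imp]
          exact ⟨hym, hwm, hsm⟩)
      rw [isWeaklyRegular_cons_iff, isWeaklyRegular_cons_iff]
      exact ⟨hy, hwy, hsreg⟩
    obtain ⟨t, ht, htm, htreg⟩ := ih (QuotSMulTop w M) (y :: s) z (by simp [hs])
      (List.forall_mem_cons.mpr ⟨hym, hsm⟩) ((isWeaklyRegular_cons_iff _ _ _).mp hwys).2 hzm hz'
    refine ⟨w :: t, by simp [ht], List.forall_mem_cons.mpr ⟨hwm, htm⟩, ?_⟩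
    have hzwt : IsWeaklyRegular M (z :: w :: t) := by
      refine IsLocalRing.isWeaklyRegular_of_perm_of_subset_maximalIdeal
        (rs := w :: z :: t) ?_ (.swap _ _ _) (by
          simp only [List.mem_cons, forall_eq_or_imp]
          exact ⟨hwm, hzm, htm⟩)
      rw [isWeaklyRegular_cons_iff, isWeaklyRegular_cons_iff]
      exact ⟨hw, hz', htreg⟩
    exact ((isWeaklyRegular_cons_iff _ _ _).mp hzwt).2

/-- The submodule `N` of elements killed by `p` is nonzero and not contained in `yM`: otherwise
regularity of `y` gives `N = yN`, against Nakayama. An element of `N` outside `yM` has a nonzero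
class killed by both `p` and `y`. -/
lemma exists_associatedPrimes_quotSMulTop {M : Type*} [AddCommGroup M] [Module R M]
    [Module.Finite R M] {y : R} (hym : y ∈ maximalIdeal R) (hy : IsSMulRegular M y)
    {p : Ideal R} (hp : p ∈ associatedPrimes R M) :
    ∃ q ∈ associatedPrimes R (QuotSMulTop y M), p ≤ q ∧ y ∈ q := by
  obtain ⟨hp1, u₀, hu₀⟩ := isAssociatedPrime_iff.mp hp
  let N : Submodule R M :=
    { carrier := {u | ∀ r ∈ p, r • u = 0}
      add_mem' := fun ha hb r hr => by rw [smul_add, ha r hr, hb r hr, add_zero]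
      zero_mem' := fun r _ => smul_zero r
      smul_mem' := fun c u hu r hr => by rw [smul_comm, hu r hr, smul_zero] }
  have hN : ¬ N ≤ y • (⊤ : Submodule R M) := by
    intro hle
    have hle' : N ≤ maximalIdeal R • N := by
      intro u hu
      have := hle hu
      rw [Submodule.mem_smul_pointwise_iff_exists] at this
      obtain ⟨v, -, rfl⟩ := this
      refine Submodule.smul_mem_smul hym fun r hr => hy ?_
      change y • r • v = y • (0 : M)
      rw [smul_comm, hu r hr, smul_zero]
    have hbot : N = ⊥ := Submodule.eq_bot_of_le_smul_of_le_jacobson_bot _ N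
      (IsNoetherian.noetherian N) hle' (IsLocalRing.maximalIdeal_le_jacobson _)
    have hmem : u₀ ∈ N := fun r hr => by
      rw [hu₀] at hr
      simpa [Submodule.mem_colon_singleton] using hr
    rw [hbot, Submodule.mem_bot] at hmem
    exact hp1.ne_top (by simp [hu₀, hmem])
  obtain ⟨u, hu, hu'⟩ := SetLike.not_le_iff_exists.mp hN
  obtain ⟨q, hq, hle⟩ := exists_le_isAssociatedPrime_of_isNoetherianRing R
    (Submodule.Quotient.mk u : QuotSMulTop y M)
    (by rwa [Ne, Submodule.Quotient.mk_eq_zero])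
  refine ⟨q, hq, fun r hr => hle ?_, hle ?_⟩
  · rw [Submodule.mem_colon_singleton, ← Submodule.Quotient.mk_smul, hu r hr]
    simp
  · rw [Submodule.mem_colon_singleton, ← Submodule.Quotient.mk_smul, Submodule.mem_bot,
      Submodule.Quotient.mk_eq_zero]
    exact Submodule.smul_mem_pointwise_smul _ _ _ trivial

/-- The depth of a module is at most the dimension of `R / p` for every associated prime `p`. -/
lemma length_le_ringKrullDim_quotient (rs : List R) : ∀ (M : Type v) [AddCommGroup M] [Module R M]
    [Module.Finite R M], (∀ r ∈ rs, r ∈ maximalIdeal R) → IsWeaklyRegular M rs →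
    ∀ p ∈ associatedPrimes R M, (rs.length : WithBot ℕ∞) ≤ ringKrullDim (R ⧸ p) := by
  induction rs with
  | nil =>
    intro M _ _ _ _ _ p hp
    have : p.IsPrime := hp.isPrime
    simpa using ringKrullDim_nonneg_of_nontrivial
  | cons y rs ih =>
    intro M _ _ _ hrs hreg p hp
    obtain ⟨hy, hreg'⟩ := (isWeaklyRegular_cons_iff _ _ _).mp hreg
    have hpp : p.IsPrime := hp.isPrime
    have hyp : y ∉ p := fun h => by
      have : y ∈ ⋃ p ∈ associatedPrimes R M, (p : Set R) := Set.mem_biUnion hp h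
      rw [biUnion_associatedPrimes_eq_compl_regular R] at this
      exact this hy
    obtain ⟨q, hq, hpq, hyq⟩ := exists_associatedPrimes_quotSMulTop (hrs y (by simp)) hy hp
    have h1 := ih (QuotSMulTop y M) (fun r hr => hrs r (by simp [hr])) hreg' q hq
    -- The class of `y` is a nonzerodivisor of the domain `R / p` that dies in `R / q`.
    have h2 : ringKrullDim (R ⧸ q) + 1 ≤ ringKrullDim (R ⧸ p) := by
      refine ringKrullDim_succ_le_of_surjective (Ideal.Quotient.factor hpq)
        (Ideal.Quotient.factor_surjective hpq) (r := Ideal.Quotient.mk p y) ?_ ?_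
      · rw [mem_nonZeroDivisors_iff_ne_zero]
        rwa [Ne, Ideal.Quotient.eq_zero_iff_mem]
      · rwa [Ideal.Quotient.factor_mk, Ideal.Quotient.eq_zero_iff_mem]
    refine le_trans ?_ h2
    simp only [List.length_cons, Nat.cast_add, Nat.cast_one]
    gcongr

/-- Each element of the Jacobson radical lowers the dimension by at most one, and modulo all of `xs`
the only prime left is the maximal one. -/
lemma ringKrullDim_quotient_le_length {p : Ideal R} [p.IsPrime] (xs : List R)
    (hxs : ∀ r ∈ xs, r ∈ maximalIdeal R)
    (h : ∀ q : Ideal R, q.IsPrime → p ≤ q → (∀ r ∈ xs, r ∈ q) → q = maximalIdeal R) :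
    ringKrullDim (R ⧸ p) ≤ xs.length := by
  classical
  have hloc : IsLocalRing (R ⧸ p) :=
    .of_surjective' (Ideal.Quotient.mk p) Ideal.Quotient.mk_surjective
  let S : Finset (R ⧸ p) := (xs.map (Ideal.Quotient.mk p)).toFinset
  have hS : (S : Set (R ⧸ p)) ⊆ Ring.jacobson (R ⧸ p) := by
    intro a ha
    rw [IsLocalRing.ringJacobson_eq_maximalIdeal]
    simp only [S, List.coe_toFinset, Set.mem_ofPred_eq, List.mem_map] at ha
    obtain ⟨r, hr, rfl⟩ := ha
    rw [SetLike.mem_coe, mem_maximalIdeal, mem_nonunits_iff, isUnit_iff_exists_inv]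
    rintro ⟨b, hb⟩
    obtain ⟨b, rfl⟩ := Ideal.Quotient.mk_surjective b
    rw [← map_mul, ← map_one (Ideal.Quotient.mk p), Ideal.Quotient.eq] at hb
    refine (maximalIdeal.isMaximal R).ne_top ((Ideal.eq_top_iff_one _).mpr ?_)
    have h1 := sub_mem (Ideal.mul_mem_right b _ (hxs r hr))
      (le_maximalIdeal (Ideal.IsPrime.ne_top ‹_›) hb)
    simp at h1
  refine (ringKrullDim_le_ringKrullDim_quotient_add_card S hS).trans ?_
  have hcard : S.card ≤ xs.length := by
    simpa using List.toFinset_card_le (xs.map (Ideal.Quotient.mk p))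
  have h0 : ringKrullDim ((R ⧸ p) ⧸ Ideal.span (S : Set (R ⧸ p))) ≤ 0 := by
    have : Ring.KrullDimLE 0 ((R ⧸ p) ⧸ Ideal.span (S : Set (R ⧸ p))) := by
      rw [Ring.krullDimLE_zero_iff]
      intro Q hQ
      let f : R →+* (R ⧸ p) ⧸ Ideal.span (S : Set (R ⧸ p)) :=
        (Ideal.Quotient.mk _).comp (Ideal.Quotient.mk p)
      have hf : Function.Surjective f :=
        Ideal.Quotient.mk_surjective.comp Ideal.Quotient.mk_surjective
      have hc : Q.comap f = maximalIdeal R := by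
        refine h _ (Ideal.comap_isPrime f Q) (fun r hr => ?_) fun r hr => ?_
        · rw [Ideal.mem_comap, RingHom.comp_apply, Ideal.Quotient.eq_zero_iff_mem.mpr hr, map_zero]
          exact zero_mem _
        · rw [Ideal.mem_comap, RingHom.comp_apply, Ideal.Quotient.eq_zero_iff_mem.mpr
            (Ideal.subset_span (by simpa [S] using ⟨r, hr, rfl⟩))]
          exact zero_mem _
      have : (Q.comap f).IsMaximal := hc ▸ inferInstance
      rw [← Ideal.map_comap_of_surjective f hf Q]
      refine (Ideal.map_eq_top_or_isMaximal_of_surjective f hf this).resolve_left ?_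
      rw [Ideal.map_comap_of_surjective f hf Q]
      exact hQ.ne_top
    exact Order.KrullDimLE.krullDim_le
  calc _ ≤ 0 + (S.card : WithBot ℕ∞) := by gcongr
    _ ≤ _ := by rw [zero_add]; exact_mod_cast hcard

/-- In a module of depth at least `n`, every sequence of `n` elements which is a system of
parameters is regular. -/
lemma isWeaklyRegular_of_forall_isPrime (xs : List R) : ∀ (M : Type v) [AddCommGroup M]
    [Module R M] [Module.Finite R M] (rs : List R), rs.length = xs.length →
    (∀ r ∈ rs, r ∈ maximalIdeal R) → IsWeaklyRegular M rs →
    (∀ r ∈ xs, r ∈ maximalIdeal R) →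
    (∀ q : Ideal R, q.IsPrime → Module.annihilator R M ≤ q → (∀ r ∈ xs, r ∈ q) →
      q = maximalIdeal R) → IsWeaklyRegular M xs := by
  induction xs with
  | nil => exact fun M _ _ _ _ _ _ _ _ _ => .nil R M
  | cons x xs ih =>
    intro M _ _ _ rs hlen hrs hreg hxs h
    -- If `x` lay in an associated prime `p`, then `xs` alone would cut `R / p` down to dimension
    -- zero, so `dim R / p ≤ xs.length`; the depth forces `dim R / p ≥ xs.length + 1`.
    have hx : IsSMulRegular M x := by
      by_contra hx
      have : x ∈ ⋃ p ∈ associatedPrimes R M, (p : Set R) := by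
        rw [biUnion_associatedPrimes_eq_compl_regular R]
        exact hx
      simp only [Set.mem_iUnion, SetLike.mem_coe] at this
      obtain ⟨p, hp, hxp⟩ := this
      have hpp : p.IsPrime := hp.isPrime
      have h1 := length_le_ringKrullDim_quotient rs M hrs hreg p hp
      have h2 := ringKrullDim_quotient_le_length (p := p) xs (fun r hr => hxs r (by simp [hr]))
        fun q hq hpq hq' => h q hq ((Submodule.annihilator_top (R := R) (M := M)) ▸ hp.annihilator_le.trans hpq) (by
          simpa [hpq hxp] using hq')
      have h3 := h1.trans h2
      rw [hlen] at h3
      have h4 : (x :: xs).length ≤ xs.length := by exact_mod_cast h3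
      simp at h4
    obtain ⟨rs', hlen', hrs', hreg'⟩ := exists_isWeaklyRegular_quotSMulTop xs.length M rs x
      (by simpa using hlen) hrs hreg (hxs x (by simp)) hx
    rw [isWeaklyRegular_cons_iff]
    refine ⟨hx, ih (QuotSMulTop x M) rs' hlen' hrs' hreg' (fun r hr => hxs r (by simp [hr]))
      fun q hq hann hq' => h q hq (le_trans ?_ hann) ?_⟩
    · exact LinearMap.annihilator_le_of_surjective _ (Submodule.mkQ_surjective _)
    · have hxq : x ∈ q := hann (by
        rw [Module.mem_annihilator]
        intro u
        obtain ⟨u, rfl⟩ := Submodule.Quotient.mk_surjective _ u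
        rw [← Submodule.Quotient.mk_smul, Submodule.Quotient.mk_eq_zero]
        exact Submodule.smul_mem_pointwise_smul _ _ _ trivial)
      simpa [hxq] using hq'

end Depth

/-- Longer sequences can be truncated, so if none had length `d`, the supremum defining the depth
would be at most `d - 1`, which is less than `d` because `d ≠ 0`. -/
lemma IsCohenMacaulayLocal.exists_isWeaklyRegular {R : Type*} [CommRing R] [IsLocalRing R]
    (h : IsCohenMacaulayLocal R) {d : ℕ} (hd : d ≠ 0) (hdim : ringKrullDim R = d) :
    ∃ rs : List R, rs.length = d ∧ (∀ r ∈ rs, r ∈ IsLocalRing.maximalIdeal R) ∧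
      RingTheory.Sequence.IsWeaklyRegular R rs := by
  have h1 : localDepth R = d := by
    have := h.depth_eq_dim.trans hdim
    exact_mod_cast this
  by_contra! hne
  have h2 : localDepth R ≤ ((d - 1 : ℕ) : ℕ∞) := by
    refine iSup₂_le fun rs hrs => ?_
    have : rs.length < d := by
      by_contra! hlt
      refine hne (rs.take d) (by simp [hlt]) (fun r hr => hrs.1 r (List.mem_of_mem_take hr)) ?_
      have := hrs.2.toIsWeaklyRegular
      rw [← List.take_append_drop d rs, RingTheory.Sequence.isWeaklyRegular_append_iff] at this
      exact this.1
    exact_mod_cast Nat.le_sub_one_of_lt this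
  rw [h1] at h2
  have : d ≤ d - 1 := by exact_mod_cast h2
  omega

/-! ### Colengths of monomial ideals -/

section Monomials

variable {R : Type*} [CommRing R]

/-- Additivity along `0 → R/(K : a) → R/K → R/(K + (a)) → 0`, where the first map is multiplication
by `a`. -/
lemma length_quotient_eq_add_colon (K : Ideal R) (a : R) :
    Module.length R (R ⧸ K) = Module.length R (R ⧸ (K ⊔ Ideal.span {a})) +
      Module.length R (R ⧸ K.colon {a}) := by
  let f : R →ₗ[R] R ⧸ K := (Submodule.mkQ K).comp (LinearMap.mulRight R a)
  have hf : LinearMap.ker f = K.colon {a} := by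
    ext r
    rw [LinearMap.mem_ker, Submodule.mem_colon_singleton, smul_eq_mul]
    exact Ideal.Quotient.eq_zero_iff_mem
  have hinj : Function.Injective ((K.colon {a}).liftQ f hf.ge) := by
    rw [← LinearMap.ker_eq_bot]
    exact Submodule.ker_liftQ_eq_bot' _ f hf.symm
  have hsurj : Function.Surjective (Submodule.factor (le_sup_left : K ≤ K ⊔ Ideal.span {a})) :=
    Submodule.factor_surjective _
  rw [Module.length_eq_add_of_exact _ _ hinj hsurj, add_comm]
  intro y
  obtain ⟨y, rfl⟩ := Submodule.Quotient.mk_surjective _ y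
  change (Submodule.Quotient.mk y : R ⧸ (K ⊔ Ideal.span {a})) = 0 ↔ _
  rw [Submodule.Quotient.mk_eq_zero, Submodule.mem_sup]
  constructor
  · rintro ⟨k, hk, z, hz, rfl⟩
    obtain ⟨r, rfl⟩ := Ideal.mem_span_singleton'.mp hz
    refine ⟨Submodule.Quotient.mk r, ?_⟩
    change Submodule.Quotient.mk (r * a) = _
    rw [Submodule.Quotient.eq]
    simpa using hk
  · rintro ⟨r, hr⟩
    obtain ⟨r, rfl⟩ := Submodule.Quotient.mk_surjective _ r
    replace hr : (Submodule.Quotient.mk (r * a) : R ⧸ K) = Submodule.Quotient.mk y := hr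
    rw [Submodule.Quotient.eq] at hr
    refine ⟨y - r * a, ?_, r * a, Ideal.mem_span_singleton'.mpr ⟨r, rfl⟩, by ring⟩
    rw [← neg_mem_iff]
    simpa using hr

lemma length_quotient_le_of_le {J K : Ideal R} (h : J ≤ K) :
    Module.length R (R ⧸ K) ≤ Module.length R (R ⧸ J) :=
  Module.length_le_of_surjective (Submodule.factor h) (Submodule.factor_surjective h)

/-- Regularity of `c` modulo `J` gives `(J + (c ^ (t + 1))) : c ^ t = J + (c)`, so each further
power adds the same length. -/
lemma length_quotient_sup_span_pow {J : Ideal R} {c : R} (hc : IsSMulRegular (R ⧸ J) c) (t : ℕ) :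
    Module.length R (R ⧸ (J ⊔ Ideal.span {c ^ t})) =
      t * Module.length R (R ⧸ (J ⊔ Ideal.span {c})) := by
  induction t with
  | zero =>
    have : J ⊔ Ideal.span {c ^ 0} = ⊤ := by simp
    rw [this]
    simp [Module.length_eq_zero]
  | succ t ih =>
    rw [length_quotient_eq_add_colon _ (c ^ t)]
    have h1 : J ⊔ Ideal.span {c ^ (t + 1)} ⊔ Ideal.span {c ^ t} = J ⊔ Ideal.span {c ^ t} := by
      rw [sup_assoc]
      congr 1
      rw [sup_eq_right, Ideal.span_singleton_le_span_singleton]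
      exact pow_dvd_pow _ (Nat.le_succ t)
    have h2 : (J ⊔ Ideal.span {c ^ (t + 1)}).colon {c ^ t} = J ⊔ Ideal.span {c} := by
      ext r
      simp only [Submodule.mem_colon_singleton, smul_eq_mul, Submodule.mem_sup,
        Ideal.mem_span_singleton']
      constructor
      · rintro ⟨j, hj, z, ⟨b, rfl⟩, hb⟩
        refine ⟨r - b * c, ?_, b * c, ⟨b, rfl⟩, by ring⟩
        have hz : (Submodule.Quotient.mk (r - b * c) : R ⧸ J) = 0 := by
          apply (hc.pow t)
          change c ^ t • (Submodule.Quotient.mk (r - b * c) : R ⧸ J) = c ^ t • 0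
          rw [smul_zero, ← Submodule.Quotient.mk_smul, Submodule.Quotient.mk_eq_zero]
          have : c ^ t • (r - b * c) = j := by
            rw [smul_eq_mul]
            linear_combination -hb
          rwa [this]
        rwa [Submodule.Quotient.mk_eq_zero] at hz
      · rintro ⟨j, hj, z, ⟨b, rfl⟩, rfl⟩
        exact ⟨j * c ^ t, Ideal.mul_mem_right _ _ hj, b * c ^ (t + 1), ⟨b, rfl⟩, by ring⟩
    rw [h1, h2, ih]
    push_cast
    ring

variable {d : ℕ} (x : Fin d → R)

/-- The ideal generated by the monomials in `x` with exponents in `A`. -/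
def monomialIdeal (A : Set (Fin d → ℕ)) : Ideal R :=
  Ideal.span ((fun a : Fin d → ℕ => ∏ i, x i ^ a i) '' A)

variable {x}

lemma prod_pow_mem_monomialIdeal {A : Set (Fin d → ℕ)} {a b : Fin d → ℕ} (ha : a ∈ A)
    (hab : a ≤ b) : ∏ i, x i ^ b i ∈ monomialIdeal x A := by
  have : (∏ i, x i ^ a i) ∣ ∏ i, x i ^ b i :=
    Finset.prod_dvd_prod_of_dvd _ _ fun i _ => pow_dvd_pow _ (hab i)
  exact Ideal.mem_of_dvd _ this (Ideal.subset_span ⟨a, ha, rfl⟩)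

lemma monomialIdeal_le {A : Set (Fin d → ℕ)} {K : Ideal R}
    (h : ∀ a ∈ A, ∏ i, x i ^ a i ∈ K) : monomialIdeal x A ≤ K := by
  rw [monomialIdeal, Ideal.span_le]
  rintro _ ⟨a, ha, rfl⟩
  exact h a ha

lemma monomialIdeal_eq_top {A : Set (Fin d → ℕ)} (h : 0 ∈ A) : monomialIdeal x A = ⊤ := by
  rw [Ideal.eq_top_iff_one]
  simpa using prod_pow_mem_monomialIdeal (x := x) h le_rfl

lemma prod_pow_add_single (a : Fin d → ℕ) (i : Fin d) (s : ℕ) :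
    ∏ j, x j ^ (a + Pi.single i s : Fin d → ℕ) j = x i ^ s * ∏ j, x j ^ a j := by
  simp only [Pi.add_apply, pow_add, Finset.prod_mul_distrib]
  rw [mul_comm]
  congr 1
  rw [Finset.prod_eq_single i]
  · simp
  · intro j _ hj
    simp [Pi.single_eq_of_ne hj]
  · simp

lemma single_le_of_le {a : Fin d → ℕ} {i : Fin d} {s : ℕ} (h : s ≤ a i) : Pi.single i s ≤ a := by
  intro j
  rcases eq_or_ne j i with rfl | hj
  · simpa
  · simp [Pi.single_eq_of_ne hj]

lemma monomialIdeal_box (s : ℕ) :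
    monomialIdeal x {a | ∃ i, s ≤ a i} = bracketPower x s := by
  have hp : ∀ i, ∏ j, x j ^ (Pi.single i s : Fin d → ℕ) j = x i ^ s := fun i => by
    simpa using prod_pow_add_single (x := x) 0 i s
  apply le_antisymm
  · refine monomialIdeal_le fun a => ?_
    rintro ⟨i, hi⟩
    have h1 : (∏ j, x j ^ (Pi.single i s : Fin d → ℕ) j) ∣ ∏ j, x j ^ a j :=
      Finset.prod_dvd_prod_of_dvd _ _ fun j _ => pow_dvd_pow _ (single_le_of_le hi j)
    rw [hp] at h1
    exact Ideal.mem_of_dvd _ h1 (Ideal.subset_span ⟨i, rfl⟩)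
  · rw [bracketPower, Ideal.span_le]
    rintro _ ⟨i, rfl⟩
    change x i ^ s ∈ _
    rw [← hp i]
    exact prod_pow_mem_monomialIdeal (a := Pi.single i s) ⟨i, by simp⟩ le_rfl

lemma sum_add_single (a : Fin d → ℕ) (i : Fin d) (s : ℕ) :
    ∑ j, (a + Pi.single i s : Fin d → ℕ) j = ∑ j, a j + s := by
  simp [Finset.sum_add_distrib]

lemma bracketPower_mul_monomialIdeal (s n : ℕ) :
    bracketPower x s * monomialIdeal x {a | n ≤ ∑ i, a i} =
      monomialIdeal x {a | (∃ i, s ≤ a i) ∧ s + n ≤ ∑ i, a i} := by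
  rw [bracketPower, monomialIdeal, Ideal.span_mul_span']
  apply le_antisymm
  · rw [Ideal.span_le]
    rintro _ ⟨_, ⟨i, rfl⟩, _, ⟨a, ha, rfl⟩, rfl⟩
    change x i ^ s * ∏ j, x j ^ a j ∈ _
    rw [← prod_pow_add_single]
    refine prod_pow_mem_monomialIdeal (a := a + Pi.single i s) ⟨⟨i, by simp⟩, ?_⟩ le_rfl
    rw [sum_add_single]
    have : n ≤ ∑ i, a i := ha
    omega
  · refine monomialIdeal_le fun a => ?_
    rintro ⟨⟨i, hi⟩, hn⟩
    have h1 : a = (a - Pi.single i s) + Pi.single i s :=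
      (tsub_add_cancel_of_le (single_le_of_le hi)).symm
    have h2 := sum_add_single (a - Pi.single i s) i s
    rw [← h1] at h2
    rw [h1, prod_pow_add_single]
    refine Ideal.subset_span ⟨_, ⟨i, rfl⟩, _, ⟨a - Pi.single i s, ?_, rfl⟩, rfl⟩
    change n ≤ _
    omega

lemma span_range_pow_eq_monomialIdeal (n : ℕ) :
    Ideal.span (Set.range x) ^ n = monomialIdeal x {a | n ≤ ∑ i, a i} := by
  induction n with
  | zero => rw [pow_zero, monomialIdeal_eq_top (by simp), Ideal.one_eq_top]
  | succ n ih =>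
    have h1 : Ideal.span (Set.range x) = bracketPower x 1 := by simp [bracketPower]
    rw [pow_succ', ih, h1, bracketPower_mul_monomialIdeal]
    congr 1
    ext a
    simp only [Set.mem_ofPred_eq]
    refine ⟨fun h => by omega, fun h => ⟨?_, by omega⟩⟩
    by_contra! h0
    have : ∑ i, a i = 0 := Finset.sum_eq_zero fun i _ => by have := h0 i; omega
    omega

/-- Each monomial contributes at most the length of `R / (x)`. -/
lemma length_quotient_monomialIdeal_le {A B : Set (Fin d → ℕ)} (hA : IsUpperSet A)
    (hB : IsUpperSet B) (S : Finset (Fin d → ℕ)) (hS : B = A ∪ S) :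
    Module.length R (R ⧸ monomialIdeal x A) ≤ Module.length R (R ⧸ monomialIdeal x B) +
      S.card * Module.length R (R ⧸ Ideal.span (Set.range x)) := by
  induction hn : S.card generalizing A S with
  | zero =>
    obtain rfl := Finset.card_eq_zero.mp hn
    obtain rfl : B = A := by simpa using hS
    simp
  | succ n ih =>
    -- Maximality of `a` keeps `insert a A` up-closed and puts every `x i * x ^ a` into the ideal of
    -- `A`, so the colon ideal by `x ^ a` contains `(x)`.
    obtain ⟨a, haS, hmax⟩ := S.exists_maximal (Finset.card_pos.mp (by omega))
    have hmax' : ∀ b, a ≤ b → b ≠ a → b ∈ A := by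
      intro b hab hne
      have haB : a ∈ B := hS ▸ Or.inr haS
      have hbB := hB hab haB
      rw [hS] at hbB
      exact hbB.resolve_right fun h => hne (le_antisymm (hmax h hab) hab)
    have hA' : IsUpperSet (insert a A) := by
      rintro b c hbc (rfl | hb)
      · by_cases h : c = b
        · exact Or.inl h
        · exact Or.inr (hmax' c hbc h)
      · exact Or.inr (hA hbc hb)
    have h1 := ih hA' (S.erase a) (by
      rw [hS]
      ext b
      by_cases hb : b = a
      · subst hb; simp [haS]
      · simp [hb]) (by rw [Finset.card_erase_of_mem haS]; omega)
    have h2 : monomialIdeal x (insert a A) =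
        monomialIdeal x A ⊔ Ideal.span {∏ i, x i ^ a i} := by
      rw [monomialIdeal, Set.image_insert_eq, Ideal.span_insert, sup_comm, monomialIdeal]
    have h3 : Ideal.span (Set.range x) ≤ (monomialIdeal x A).colon {∏ i, x i ^ a i} := by
      rw [Ideal.span_le]
      rintro _ ⟨i, rfl⟩
      rw [SetLike.mem_coe, Submodule.mem_colon_singleton, smul_eq_mul]
      have h4 := prod_pow_add_single (x := x) a i 1
      rw [pow_one] at h4
      rw [← h4]
      refine prod_pow_mem_monomialIdeal (hmax' _ le_self_add fun h => ?_) le_rfl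
      have := congrFun h i
      simp at this
    rw [length_quotient_eq_add_colon _ (∏ i, x i ^ a i), ← h2]
    calc _ ≤ (Module.length R (R ⧸ monomialIdeal x B) +
          n * Module.length R (R ⧸ Ideal.span (Set.range x))) +
          Module.length R (R ⧸ Ideal.span (Set.range x)) :=
        add_le_add h1 (length_quotient_le_of_le h3)
      _ = _ := by push_cast; ring

/-- If each of the ideals `(x₁ ^ s, …, x_d ^ s)` has the expected colength, then the colength of an
ideal generated by monomials is computed by counting the monomials outside of it. -/
lemma length_quotient_monomialIdeal
    (hfin : Module.length R (R ⧸ Ideal.span (Set.range x)) ≠ ⊤)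
    (hbox : ∀ s : ℕ, s ≠ 0 → Module.length R (R ⧸ bracketPower x s) =
      (s ^ d : ℕ) * Module.length R (R ⧸ Ideal.span (Set.range x)))
    {A : Set (Fin d → ℕ)} (hA : IsUpperSet A) (S : Finset (Fin d → ℕ)) (hS : ∀ a, a ∈ S ↔ a ∉ A) :
    Module.length R (R ⧸ monomialIdeal x A) =
      S.card * Module.length R (R ⧸ Ideal.span (Set.range x)) := by
  classical
  have hle := @length_quotient_monomialIdeal_le R _ d x
  generalize Module.length R (R ⧸ Ideal.span (Set.range x)) = e at hfin hbox hle ⊢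
  have hupper : Module.length R (R ⧸ monomialIdeal x A) ≤ S.card * e := by
    have := hle hA isUpperSet_univ S (by
      ext a; simp [hS, em])
    rwa [monomialIdeal_eq_top (Set.mem_univ _), Module.length_eq_zero (M := R ⧸ (⊤ : Ideal R)),
      zero_add] at this
  obtain ⟨s, hs0, hs⟩ : ∃ s : ℕ, s ≠ 0 ∧ ∀ a ∈ S, ∀ i, a i < s := by
    refine ⟨∑ a ∈ S, ∑ i, a i + 1, by omega, fun a ha i => ?_⟩
    have h1 : a i ≤ ∑ i, a i := Finset.single_le_sum (fun _ _ => Nat.zero_le _) (Finset.mem_univ i)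
    have h2 : ∑ i, a i ≤ ∑ a ∈ S, ∑ i, a i :=
      Finset.single_le_sum (f := fun a : Fin d → ℕ => ∑ i, a i) (fun _ _ => Nat.zero_le _) ha
    omega
  let box : Finset (Fin d → ℕ) := Fintype.piFinset fun _ => Finset.range s
  have hmem : ∀ a, a ∈ box ↔ ∀ i, a i < s := fun a => by simp [box]
  have hSbox : S ⊆ box := fun a ha => (hmem a).mpr (hs a ha)
  have hcard : box.card = s ^ d := by simp [box]
  -- The upper bound for passing from the box ideal to `A` reads `s ^ d * e ≤ ℓ(R / A) + (s ^ d -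
  -- S.card) * e`. As the colength of the box is known exactly, this is the missing lower bound.
  have hlower := hle (A := {a | ∃ i, s ≤ a i}) (B := A)
    (fun a b hab ⟨i, hi⟩ => ⟨i, hi.trans (hab i)⟩) hA (box \ S) (by
      ext a
      simp only [Set.mem_union, Set.mem_ofPred_eq, Finset.coe_sdiff, Set.mem_sdiff,
        Finset.mem_coe, hmem, hS, not_not]
      constructor
      · intro ha
        by_cases h : ∃ i, s ≤ a i
        · exact Or.inl h
        · exact Or.inr ⟨by simpa using h, ha⟩
      · rintro (⟨i, hi⟩ | h)
        · by_contra ha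
          exact absurd (hs a ((hS a).mpr ha) i) (by omega)
        · exact h.2)
  rw [monomialIdeal_box, hbox s hs0, ← hcard, ← Finset.card_sdiff_add_card_eq_card hSbox] at hlower
  refine le_antisymm hupper ?_
  have hne : Module.length R (R ⧸ monomialIdeal x A) ≠ ⊤ :=
    ne_top_of_le_ne_top (WithTop.mul_ne_top (ENat.natCast_ne_top _) hfin) hupper
  revert hlower
  lift Module.length R (R ⧸ monomialIdeal x A) to ℕ using hne with l
  lift e to ℕ using hfin
  norm_cast
  intro h
  linarith

end Monomials

/-! ### Parameters in Cohen–Macaulay rings -/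

section Parameters

open IsLocalRing RingTheory.Sequence

variable {R : Type*} [CommRing R] {d : ℕ}

lemma span_range_eq_sup (y : Fin d → R) (i : Fin d) :
    Ideal.span (Set.range y) = Ideal.span (y '' {i}ᶜ) ⊔ Ideal.span {y i} := by
  rw [← Ideal.span_union, ← Set.image_singleton, ← Set.image_union, Set.compl_union_self,
    Set.image_univ]

lemma radical_span_range_pow {x : Fin d → R} {t : Fin d → ℕ} (ht : ∀ i, t i ≠ 0) :
    (Ideal.span (Set.range fun i => x i ^ t i)).radical = (Ideal.span (Set.range x)).radical := by
  apply le_antisymm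
  · refine Ideal.radical_mono (Ideal.span_le.mpr ?_)
    rintro _ ⟨i, rfl⟩
    exact Ideal.pow_mem_of_mem _ (Ideal.subset_span (Set.mem_range_self i)) _ (Nat.pos_of_ne_zero (ht i))
  · refine Ideal.radical_le_radical_iff.mpr (Ideal.span_le.mpr ?_)
    rintro _ ⟨i, rfl⟩
    change x i ∈ Ideal.radical _
    exact Ideal.mem_radical_iff.mpr ⟨t i, Ideal.subset_span ⟨i, rfl⟩⟩

variable [IsLocalRing R]

/-- In a Cohen-Macaulay local ring, an element of a system of parameters is regular modulo the
others. -/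
lemma isSMulRegular_quotient_span_image_erase [IsNoetherianRing R] {rs : List R}
    (hlen : rs.length = d) (hrs : ∀ r ∈ rs, r ∈ maximalIdeal R) (hreg : IsWeaklyRegular R rs)
    {y : Fin d → R} (hy : (Ideal.span (Set.range y)).radical = maximalIdeal R) (i : Fin d) :
    IsSMulRegular (R ⧸ Ideal.span (y '' {i}ᶜ)) (y i) := by
  have hym : ∀ j, y j ∈ maximalIdeal R := fun j =>
    hy ▸ Ideal.le_radical (Ideal.subset_span ⟨j, rfl⟩)
  -- Listing `y i` last makes regularity of the sequence say exactly that `y i` is regular modulo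
  -- the others.
  let others : List R := (Finset.univ.erase i).toList.map y
  have hothers : ∀ r, r ∈ others ↔ r ∈ y '' {i}ᶜ := fun r => by
    simp [others]
  have h := isWeaklyRegular_of_forall_isPrime (others ++ [y i]) R rs
    (by
      have := i.pos
      simp [others, hlen, Finset.card_erase_of_mem]
      omega) hrs hreg
    (fun r hr => by
      rcases List.mem_append.mp hr with hr | hr
      · obtain ⟨j, -, rfl⟩ := (hothers r).mp hr
        exact hym j
      · rw [List.mem_singleton.mp hr]
        exact hym i)
    (fun q hq _ hq' => by
      have hle : maximalIdeal R ≤ q := by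
        rw [← hy, Ideal.IsPrime.radical_le_iff hq, Ideal.span_le]
        rintro _ ⟨j, rfl⟩
        by_cases hj : j = i
        · exact hq' _ (by simp [hj])
        · exact hq' _ (List.mem_append_left _ ((hothers _).mpr ⟨j, hj, rfl⟩))
      exact ((maximalIdeal.isMaximal R).eq_of_le hq.ne_top hle).symm)
  rw [isWeaklyRegular_append_iff, isWeaklyRegular_singleton_iff] at h
  have heq : (Ideal.ofList others • ⊤ : Submodule R R) = Ideal.span (y '' {i}ᶜ) := by
    rw [smul_eq_mul, Ideal.mul_top, Ideal.ofList]
    congr 1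
    ext r
    exact hothers r
  exact ((Submodule.quotEquivOfEq _ _ heq).isSMulRegular_congr _).mp h.2

lemma length_quotient_bracketPower [IsNoetherianRing R] {rs : List R}
    (hlen : rs.length = d) (hrs : ∀ r ∈ rs, r ∈ maximalIdeal R) (hreg : IsWeaklyRegular R rs)
    {x : Fin d → R} (hx : (Ideal.span (Set.range x)).radical = maximalIdeal R) {s : ℕ}
    (hs : s ≠ 0) :
    Module.length R (R ⧸ bracketPower x s) =
      (s ^ d : ℕ) * Module.length R (R ⧸ Ideal.span (Set.range x)) := by
  classical
  -- The exponents are raised from `1` to `s` one variable at a time, `T` being the set already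
  -- treated. The mixed powers still form a system of parameters, so each step multiplies the length
  -- by `s`.
  have key : ∀ T : Finset (Fin d),
      Module.length R (R ⧸ Ideal.span (Set.range fun i => x i ^ (if i ∈ T then s else 1))) =
        (s ^ T.card : ℕ) * Module.length R (R ⧸ Ideal.span (Set.range x)) := by
    intro T
    induction T using Finset.induction_on with
    | empty =>
      have h1 : (Set.range fun i => x i ^ (if i ∈ (∅ : Finset (Fin d)) then s else 1)) =
          Set.range x := by simp
      rw [h1]
      simp
    | insert i T hi ih =>
      let y : Fin d → R := fun j => x j ^ (if j ∈ T then s else 1)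
      have hyi : y i = x i := by simp [y, hi]
      have hreg' := isSMulRegular_quotient_span_image_erase hlen hrs hreg (y := y)
        ((radical_span_range_pow fun j => by split_ifs <;> omega).trans hx) i
      have h1 : Ideal.span (Set.range fun j => x j ^ (if j ∈ insert i T then s else 1)) =
          Ideal.span (y '' {i}ᶜ) ⊔ Ideal.span {y i ^ s} := by
        rw [span_range_eq_sup _ i]
        congr 2
        · refine Set.image_congr fun j hj => ?_
          have hj' : j ≠ i := hj
          simp [y, hj']
        · simp [hyi]
      rw [h1, length_quotient_sup_span_pow hreg', ← span_range_eq_sup, ih,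
        Finset.card_insert_of_notMem hi]
      push_cast
      ring
  have h1 : bracketPower x s =
      Ideal.span (Set.range fun i => x i ^ (if i ∈ Finset.univ then s else 1)) := by
    simp [bracketPower]
  rw [h1, key, Finset.card_univ, Fintype.card_fin]

lemma length_quotient_ne_top_of_radical_eq [IsNoetherianRing R] {I : Ideal R}
    (hI : I.radical = maximalIdeal R) : Module.length R (R ⧸ I) ≠ ⊤ := by
  have : Ring.KrullDimLE 0 (R ⧸ I) := by
    rw [Ideal.krullDimLE_zero_quotient_iff_forall_minimalPrimes_isMaximal]
    intro J hJ
    have hJp : J.IsPrime := hJ.1.1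
    have hle : maximalIdeal R ≤ J := hI ▸ (Ideal.IsPrime.radical_le_iff hJp).mpr hJ.1.2
    rw [← (maximalIdeal.isMaximal R).eq_of_le hJp.ne_top hle]
    infer_instance
  have : IsArtinianRing (R ⧸ I) := IsNoetherianRing.isArtinianRing_of_krullDimLE_zero
  rw [Module.length_eq_of_surjective (R := R ⧸ I) (S := R) (M := R ⧸ I)
    Ideal.Quotient.mk_surjective]
  exact Module.length_ne_top

end Parameters

/-! ### Counting exponents -/

section Counting

/-- The exponents of the monomials of degree less than `N` in `d` variables. -/
def simplex (d N : ℕ) : Finset (Fin d → ℕ) :=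
  (Fintype.piFinset fun _ => Finset.range N).filter fun a => ∑ i, a i < N

@[simp]
lemma mem_simplex {d N : ℕ} {a : Fin d → ℕ} : a ∈ simplex d N ↔ ∑ i, a i < N := by
  simp only [simplex, Finset.mem_filter, Fintype.mem_piFinset, Finset.mem_range,
    and_iff_right_iff_imp]
  exact fun h i =>
    (Finset.single_le_sum (fun _ _ => Nat.zero_le _) (Finset.mem_univ i)).trans_lt h

lemma card_simplex (k N : ℕ) : (simplex (k + 1) N).card = (N + k).choose (k + 1) := by
  induction N with
  | zero =>
    rw [zero_add, Nat.choose_eq_zero_of_lt (Nat.lt_succ_self k), Finset.card_eq_zero,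
      Finset.eq_empty_iff_forall_notMem]
    intro a
    simp
  | succ N ih =>
    have h1 : simplex (k + 1) (N + 1) = simplex (k + 1) N ∪
        (Finset.univ.finsuppAntidiag N).map Finsupp.equivFunOnFinite.toEmbedding := by
      ext a
      simp only [mem_simplex, Finset.mem_union, Finset.mem_map, Finset.mem_finsuppAntidiag]
      constructor
      · intro h
        rcases Nat.lt_succ_iff_lt_or_eq.mp h with h | h
        · exact Or.inl h
        · exact Or.inr ⟨Finsupp.equivFunOnFinite.symm a, ⟨by simpa using h, by simp⟩, by simp⟩
      · rintro (h | ⟨b, ⟨hb, -⟩, rfl⟩)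
        · omega
        · simpa using hb.le
    rw [h1, Finset.card_union_of_disjoint, ih, Finset.card_map,
      Finset.card_finsuppAntidiag_nat_eq_choose, Finset.card_univ, Fintype.card_fin]
    · have h2 : (k + 1 + N - 1).choose N = (N + k).choose k := by
        rw [show k + 1 + N - 1 = N + k by omega]
        exact (Nat.choose_symm_add)
      rw [h2, show N + 1 + k = N + k + 1 by omega, Nat.choose_succ_succ, add_comm]
    · rw [Finset.disjoint_left]
      intro a ha hb
      simp only [Finset.mem_map, Finset.mem_finsuppAntidiag] at hb
      obtain ⟨b, ⟨hb, -⟩, rfl⟩ := hb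
      rw [mem_simplex] at ha
      have : ∑ i, b i = N := hb
      simp [this] at ha

/-- Translation by `s` in the directions of `t`. Truncated subtraction is harmless: if `t.card * s ≥
N`, both sides are empty. -/
lemma card_simplex_filter_forall_le (d N s : ℕ) (t : Finset (Fin d)) :
    ((simplex d N).filter fun a => ∀ i ∈ t, s ≤ a i).card = (simplex d (N - t.card * s)).card := by
  let c : Fin d → ℕ := fun i => if i ∈ t then s else 0
  have hc : ∑ i, c i = t.card * s := by simp [c]
  refine Finset.card_nbij' (fun a => a - c) (fun a => a + c) ?_ ?_ ?_ ?_
  · intro a ha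
    simp only [Finset.coe_filter, mem_simplex, Set.mem_ofPred_eq] at ha
    have hle : c ≤ a := fun i => by
      by_cases h : i ∈ t
      · simpa [c, h] using ha.2 i h
      · simp [c, h]
    rw [Finset.mem_coe, mem_simplex]
    change ∑ i, (a - c) i < _
    have h1 : ∑ i, (a - c) i + ∑ i, c i = ∑ i, a i := by
      rw [← Finset.sum_add_distrib]
      exact Finset.sum_congr rfl fun i _ => Nat.sub_add_cancel (hle i)
    omega
  · intro a ha
    rw [Finset.mem_coe, mem_simplex] at ha
    simp only [Finset.coe_filter, mem_simplex, Set.mem_ofPred_eq, Pi.add_apply,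
      Finset.sum_add_distrib, hc]
    exact ⟨by omega, fun i hi => by simp [c, hi]⟩
  · intro a ha
    simp only [Finset.coe_filter, mem_simplex, Set.mem_ofPred_eq] at ha
    refine tsub_add_cancel_of_le fun i => ?_
    by_cases h : i ∈ t
    · simpa [c, h] using ha.2 i h
    · simp [c, h]
  · intro a _
    exact add_tsub_cancel_right a c

/-- The number of monomials of degree less than `s + n` in `d` variables which are divisible by
the `s`-th power of some variable. -/
def bracketCount (d s n : ℕ) : ℕ :=
  ((simplex d (s + n)).filter fun a => ∃ i, s ≤ a i).card

lemma bracketCount_add_card (d s n : ℕ) :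
    bracketCount d s n + ((simplex d (s + n)).filter fun a => ∀ i, a i < s).card =
      (simplex d (s + n)).card := by
  rw [bracketCount, ← Finset.card_filter_add_card_filter_not (s := simplex d (s + n))
    fun a => ∃ i, s ≤ a i]
  simp

/-- The indicator of the box is `∏ (1 - [s ≤ a i])`; expanding it gives a sum over subsets whose
terms depend only on their size. -/
lemma card_simplex_filter_forall_lt (d N s : ℕ) :
    (((simplex d N).filter fun a => ∀ i, a i < s).card : ℤ) =
      ∑ m ∈ Finset.range (d + 1),
        (-1 : ℤ) ^ m * (d.choose m : ℤ) * ((simplex d (N - m * s)).card : ℤ) := by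
  have h1 : (((simplex d N).filter fun a => ∀ i, a i < s).card : ℤ) =
      ∑ a ∈ simplex d N, ∏ i, ((1 : ℤ) - if s ≤ a i then 1 else 0) := by
    rw [Finset.card_filter]
    push_cast
    refine Finset.sum_congr rfl fun a _ => ?_
    split_ifs with h
    · refine (Finset.prod_eq_one fun i _ => ?_).symm
      simp [(h i).not_ge]
    · push Not at h
      obtain ⟨i, hi⟩ := h
      exact (Finset.prod_eq_zero (Finset.mem_univ i) (by simp [hi])).symm
  have h2 : ∀ t : Finset (Fin d), ∑ a ∈ simplex d N, ∏ i ∈ t, (if s ≤ a i then (1 : ℤ) else 0) =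
      ((simplex d (N - t.card * s)).card : ℤ) := by
    intro t
    rw [← card_simplex_filter_forall_le, Finset.card_filter]
    push_cast
    refine Finset.sum_congr rfl fun a _ => ?_
    rw [Finset.prod_ite_zero]
    simp
  have h3 := Finset.sum_powerset_apply_card
    (fun m => (-1 : ℤ) ^ m * ((simplex d (N - m * s)).card : ℤ)) (x := (Finset.univ : Finset (Fin d)))
  rw [Finset.card_univ, Fintype.card_fin] at h3
  rw [h1]
  simp_rw [Finset.prod_sub, Finset.prod_const_one]
  rw [Finset.sum_comm]
  simp only [mul_one, ← Finset.mul_sum, h2]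
  rw [h3]
  refine Finset.sum_congr rfl fun m _ => ?_
  rw [nsmul_eq_mul]
  ring

/-- Inclusion-exclusion for the monomials divisible by the `s`-th power of some variable. -/
lemma bracketCount_eq_sum (d s n : ℕ) :
    (bracketCount d s n : ℤ) = ∑ m ∈ Finset.Icc 1 d,
      (-1 : ℤ) ^ (m + 1) * (d.choose m : ℤ) * ((simplex d (s + n - m * s)).card : ℤ) := by
  have h1 := bracketCount_add_card d s n
  have h2 := card_simplex_filter_forall_lt d (s + n) s
  rw [Finset.sum_range_succ', Finset.sum_range (n := d)] at h2
  rw [← Finset.sum_range (n := d) (f := fun m => (-1 : ℤ) ^ (m + 1) * (d.choose (m + 1) : ℤ) *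
    ((simplex d (s + n - (m + 1) * s)).card : ℤ))] at h2
  have h3 : ∑ m ∈ Finset.Icc 1 d,
      (-1 : ℤ) ^ (m + 1) * (d.choose m : ℤ) * ((simplex d (s + n - m * s)).card : ℤ) =
      - ∑ m ∈ Finset.range d, (-1 : ℤ) ^ (m + 1) * (d.choose (m + 1) : ℤ) *
        ((simplex d (s + n - (m + 1) * s)).card : ℤ) := by
    rw [← Finset.sum_neg_distrib, ← Finset.Ico_add_one_right_eq_Icc, Finset.sum_Ico_eq_sum_range]
    refine Finset.sum_congr rfl fun m _ => ?_
    rw [add_comm 1 m]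
    ring
  rw [h3]
  simp only [pow_zero, Nat.choose_zero_right, Nat.cast_one, one_mul, zero_mul, Nat.sub_zero] at h2
  have h4 : (bracketCount d s n : ℤ) +
      (((simplex d (s + n)).filter fun a => ∀ i, a i < s).card : ℤ) =
      ((simplex d (s + n)).card : ℤ) := by exact_mod_cast h1
  linarith

/-- A point with all coordinates below `s` has degree less than `d * s ≤ s + n`, so the degree
condition holds on the whole box. -/
lemma bracketCount_of_le {d s n : ℕ} (hd : 1 ≤ d) (h : (d - 1) * s ≤ n) :
    bracketCount d s n + s ^ d = (simplex d (s + n)).card := by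
  rw [← bracketCount_add_card d s n]
  congr 1
  have h1 : ((simplex d (s + n)).filter fun a => ∀ i, a i < s) =
      Fintype.piFinset fun _ => Finset.range s := by
    ext a
    simp only [Finset.mem_filter, mem_simplex, Fintype.mem_piFinset, Finset.mem_range,
      and_iff_right_iff_imp]
    intro ha
    have : Nonempty (Fin d) := ⟨⟨0, hd⟩⟩
    have h2 : ∑ i, a i < ∑ _i : Fin d, s :=
      Finset.sum_lt_sum_of_nonempty Finset.univ_nonempty fun i _ => ha i
    obtain ⟨k, rfl⟩ := Nat.exists_eq_add_of_le' hd
    simp only [Finset.sum_const, Finset.card_univ, Fintype.card_fin, smul_eq_mul] at h2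
    simp only [Nat.add_sub_cancel] at h
    nlinarith
  rw [h1]
  simp

end Counting

/-! ### The lengths as multiples of `ℓ(R/I)` -/

section HilbertFunction

open IsLocalRing RingTheory.Sequence

variable {R : Type*} [CommRing R] [IsLocalRing R] [IsNoetherianRing R] {d : ℕ} {rs : List R}
  {x : Fin d → R}

lemma lengthPow_span_range (hlen : rs.length = d) (hrs : ∀ r ∈ rs, r ∈ maximalIdeal R)
    (hreg : IsWeaklyRegular R rs) (hx : (Ideal.span (Set.range x)).radical = maximalIdeal R)
    (n : ℤ) :
    lengthPow (Ideal.span (Set.range x)) n =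
      (simplex d n.toNat).card * Module.length R (R ⧸ Ideal.span (Set.range x)) := by
  rw [lengthPow, span_range_pow_eq_monomialIdeal]
  refine length_quotient_monomialIdeal (length_quotient_ne_top_of_radical_eq hx)
    (fun s hs => length_quotient_bracketPower hlen hrs hreg hx hs)
    (A := {a | n.toNat ≤ ∑ i, a i}) (fun a b hab ha => ?_) _ fun a => ?_
  · exact le_trans ha (Finset.sum_le_sum fun i _ => hab i)
  · rw [mem_simplex, Set.mem_ofPred_eq, not_le]

lemma lengthBracket_eq (hlen : rs.length = d) (hrs : ∀ r ∈ rs, r ∈ maximalIdeal R)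
    (hreg : IsWeaklyRegular R rs) (hx : (Ideal.span (Set.range x)).radical = maximalIdeal R)
    (s n : ℕ) :
    lengthBracket x s n =
      bracketCount d s n * Module.length R (R ⧸ Ideal.span (Set.range x)) := by
  classical
  have hfin := length_quotient_ne_top_of_radical_eq hx
  have hbox := fun s hs => length_quotient_bracketPower (s := s) hlen hrs hreg hx hs
  let B : Finset (Fin d → ℕ) := Fintype.piFinset fun _ => Finset.range s
  let C : Finset (Fin d → ℕ) := (simplex d (s + n)).filter fun a => ∃ i, s ≤ a i
  have hB : ∀ a, a ∈ B ↔ ∀ i, a i < s := fun a => by simp [B]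
  have hdisj : Disjoint B C := by
    rw [Finset.disjoint_left]
    intro a ha hC
    obtain ⟨i, hi⟩ := (Finset.mem_filter.mp hC).2
    exact absurd ((hB a).mp ha i) (by omega)
  have h1 := length_quotient_monomialIdeal hfin hbox (A := {a | ∃ i, s ≤ a i})
    (fun a b hab ⟨i, hi⟩ => ⟨i, hi.trans (hab i)⟩) B (fun a => by simp [hB])
  have h2 := length_quotient_monomialIdeal hfin hbox
    (A := {a | (∃ i, s ≤ a i) ∧ s + n ≤ ∑ i, a i})
    (fun a b hab ⟨⟨i, hi⟩, h⟩ =>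
      ⟨⟨i, hi.trans (hab i)⟩, h.trans (Finset.sum_le_sum fun i _ => hab i)⟩) (B ∪ C) (fun a => by
      simp only [Finset.mem_union, hB, C, Finset.mem_filter, mem_simplex, Set.mem_ofPred_eq,
        not_and, not_le]
      constructor
      · rintro (h | h) ⟨i, hi⟩
        · exact absurd (h i) (by omega)
        · exact h.1
      · intro h
        by_cases h' : ∃ i, s ≤ a i
        · exact Or.inr ⟨h h', h'⟩
        · exact Or.inl (by simpa using h'))
  rw [monomialIdeal_box] at h1
  rw [← bracketPower_mul_monomialIdeal, ← span_range_pow_eq_monomialIdeal] at h2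
  -- Comparing colengths in `R` leaves the contribution of `C`, because the exponents outside the
  -- product are those of the disjoint union of `B` and `C`. Cancelling `B` in `ℕ∞` needs its
  -- contribution to be finite.
  have h3 : Module.length R (R ⧸ bracketPower x s * Ideal.span (Set.range x) ^ n) =
      lengthBracket x s n + Module.length R (R ⧸ bracketPower x s) := by
    set K := bracketPower x s * Ideal.span (Set.range x) ^ n with hK
    have hle : K ≤ bracketPower x s := Ideal.mul_le_left
    let f := Submodule.mapQ (K.submoduleOf (bracketPower x s)) K (bracketPower x s).subtype le_rfl
    refine Module.length_eq_add_of_exact f (Submodule.factor hle) ?_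
      (Submodule.factor_surjective hle) ?_
    · rw [← LinearMap.ker_eq_bot]
      exact Submodule.ker_liftQ_eq_bot' _ _ (by
        rw [LinearMap.ker_comp, Submodule.ker_mkQ]
        rfl)
    · intro y
      obtain ⟨y, rfl⟩ := Submodule.Quotient.mk_surjective _ y
      change (Submodule.Quotient.mk y : R ⧸ bracketPower x s) = 0 ↔ _
      rw [Submodule.Quotient.mk_eq_zero]
      constructor
      · intro hy
        exact ⟨Submodule.Quotient.mk ⟨y, hy⟩, rfl⟩
      · rintro ⟨z, hz⟩
        obtain ⟨z, rfl⟩ := Submodule.Quotient.mk_surjective _ z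
        replace hz : (Submodule.Quotient.mk (z : R) : R ⧸ K) = Submodule.Quotient.mk y := hz
        rw [Submodule.Quotient.eq] at hz
        have := sub_mem z.2 (hle hz)
        simpa using this
  rw [h1, h2, Finset.card_union_of_disjoint hdisj] at h3
  have hC : C.card = bracketCount d s n := rfl
  rw [hC] at h3
  revert h3
  generalize Module.length R (R ⧸ Ideal.span (Set.range x)) = e at hfin
  lift e to ℕ using hfin
  intro h3
  push_cast at h3
  rw [add_mul, add_comm] at h3
  have hne : ((B.card : ℕ∞) * (e : ℕ∞)) ≠ ⊤ := by
    rw [← Nat.cast_mul]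
    exact ENat.natCast_ne_top _
  exact ((ENat.add_left_injective_of_ne_top hne) h3).symm

end HilbertFunction

/-! ### The Hilbert–Samuel polynomial -/

/-- The polynomial `e * binom (X + d - 1) d`. -/
noncomputable def binomialPolynomial (d e : ℕ) : ℚ[X] :=
  C ((e : ℚ) / (d.factorial : ℚ)) * ascPochhammer ℚ d

lemma natDegree_binomialPolynomial (d : ℕ) {e : ℕ} (he : e ≠ 0) :
    (binomialPolynomial d e).natDegree = d := by
  rw [binomialPolynomial, natDegree_C_mul (by positivity), ascPochhammer_natDegree]

lemma factorial_mul_coeff_binomialPolynomial (d e : ℕ) :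
    (d.factorial : ℚ) * (binomialPolynomial d e).coeff d = e := by
  have h : (ascPochhammer ℚ d).coeff d = 1 := by
    have := monic_ascPochhammer ℚ d
    rwa [Monic, leadingCoeff, ascPochhammer_natDegree] at this
  have := d.factorial_ne_zero
  rw [binomialPolynomial, coeff_C_mul, h]
  field_simp

/-- For `d = 0` this fails at `n = 0`: the polynomial is the constant `e`, while the simplex is
empty. -/
lemma eval_binomialPolynomial {d : ℕ} (hd : 1 ≤ d) (e n : ℕ) :
    (binomialPolynomial d e).eval (n : ℚ) = (simplex d n).card * e := by
  obtain ⟨k, rfl⟩ := Nat.exists_eq_add_of_le' hd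
  have h := Nat.ascFactorial_eq_factorial_mul_choose' n (k + 1)
  have := (k + 1).factorial_ne_zero
  rw [binomialPolynomial, eval_mul, eval_C, ← ascPochhammer_eval_cast,
    ascPochhammer_nat_eq_ascFactorial, h, card_simplex]
  push_cast
  field_simp
  simp

lemma IsHilbertPolynomial.eq {R : Type*} [CommRing R] {I : Ideal R} {P Q : ℚ[X]}
    (hP : IsHilbertPolynomial I P) (hQ : IsHilbertPolynomial I Q) : P = Q := by
  refine Polynomial.eq_of_infinite_eval_eq P Q ?_
  obtain ⟨N, hN⟩ := Filter.eventually_atTop.mp (hP.and hQ)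
  refine Set.infinite_of_injective_forall_mem (f := fun n : ℕ => ((n + N : ℕ) : ℚ))
    (fun a b hab => by simpa using hab) fun n => ?_
  obtain ⟨h1, h2⟩ := hN (n + N) (Nat.le_add_left _ _)
  exact h1.2.symm.trans h2.2

lemma IsHilbertPolynomial.hilbertPolynomial_eq {R : Type*} [CommRing R] {I : Ideal R} {P : ℚ[X]}
    (hP : IsHilbertPolynomial I P) : hilbertPolynomial I = P := by
  have h : ∃ P : ℚ[X], IsHilbertPolynomial I P := ⟨P, hP⟩
  rw [hilbertPolynomial, dif_pos h]
  exact h.choose_spec.eq hP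

end HilbertKunz

/-! ### The formula -/

theorem theorem3 {R : Type*} [CommRing R] [IsLocalRing R]
    (hCM : HilbertKunz.IsCohenMacaulayLocal R)
    (d : ℕ) (hd : 2 ≤ d) (hdim : ringKrullDim R = d)
    (I : Ideal R) (hI : HilbertKunz.IsParameterIdeal I) :
    -- the quantities on the right are well defined:
    -- `I` has a Hilbert-Samuel polynomial, of degree `d`, and the lengths `H(n)` are finite
    (HilbertKunz.IsHilbertPolynomial I (HilbertKunz.hilbertPolynomial I) ∧
      (HilbertKunz.hilbertPolynomial I).natDegree = d ∧
      ∀ n : ℤ, HilbertKunz.lengthPow I n ≠ ⊤) ∧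
    -- the formula for `F(s, n)`, for every system of `d` generators of `I`
    (∀ x : Fin d → R, Ideal.span (Set.range x) = I → ∀ s n : ℕ,
      HilbertKunz.lengthBracket x s n ≠ ⊤ ∧
      (1 ≤ n → n ≤ s → HilbertKunz.F x s n = (d : ℚ) * HilbertKunz.H I n) ∧
      (s + 1 ≤ n → (n : ℤ) ≤ ((d : ℤ) - 1) * s - 1 →
        HilbertKunz.F x s n =
          ∑ i ∈ Finset.Icc 1 (d - 1), (-1 : ℚ) ^ (i + 1) * (d.choose i : ℚ) *
            HilbertKunz.H I ((n : ℤ) - ((i : ℤ) - 1) * s)) ∧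
      (((d : ℤ) - 1) * s ≤ n →
        HilbertKunz.F x s n =
          HilbertKunz.H I ((n : ℤ) + s) - (s : ℚ) ^ d * HilbertKunz.e₀ d I)) ∧
    -- independence of the generators
    (∀ x y : Fin d → R, Ideal.span (Set.range x) = I → Ideal.span (Set.range y) = I →
      ∀ s n : ℕ, HilbertKunz.lengthBracket x s n = HilbertKunz.lengthBracket y s n) := by
  open HilbertKunz in
  have hN : IsNoetherianRing R := hCM.isNoetherianRing
  have hd1 : 1 ≤ d := by omega
  obtain ⟨rs, hlen, hrs, hreg⟩ := hCM.exists_isWeaklyRegular (by omega) hdim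
  obtain ⟨d', x₀, ⟨hdim', hrad⟩, hx₀⟩ := hI
  have hdd : d = d' := by
    have := hdim.symm.trans hdim'
    exact_mod_cast this
  subst hdd
  rw [hx₀] at hrad
  have hne0 : Module.length R (R ⧸ I) ≠ 0 := by
    have htop : I ≠ ⊤ := by
      rintro rfl
      rw [Ideal.radical_top] at hrad
      exact (IsLocalRing.maximalIdeal.isMaximal R).ne_top hrad.symm
    have : Nontrivial (R ⧸ I) := Ideal.Quotient.nontrivial_iff.mpr htop
    exact Module.length_pos.ne'
  obtain ⟨e, he⟩ : ∃ e : ℕ, Module.length R (R ⧸ I) = e :=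
    ⟨_, (ENat.natCast_toNat (length_quotient_ne_top_of_radical_eq hrad)).symm⟩
  have he0 : e ≠ 0 := by
    rintro rfl
    exact hne0 (by simpa using he)
  have hpow : ∀ n : ℤ, lengthPow I n = (((simplex d n.toNat).card * e : ℕ) : ℕ∞) := by
    intro n
    have := lengthPow_span_range hlen hrs hreg (x := x₀) (by rw [hx₀, hrad]) n
    rw [hx₀, he] at this
    rw [this]
    push_cast
    rfl
  have hH : ∀ n : ℤ, H I n = (simplex d n.toNat).card * e := by
    intro n
    rw [H, hpow, ENat.toNat_natCast]
    push_cast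
    rfl
  have hbr : ∀ x : Fin d → R, Ideal.span (Set.range x) = I → ∀ s n : ℕ,
      lengthBracket x s n = ((bracketCount d s n * e : ℕ) : ℕ∞) := by
    intro x hx s n
    have := lengthBracket_eq hlen hrs hreg (x := x) (by rw [hx, hrad]) s n
    rw [hx, he] at this
    rw [this]
    push_cast
    rfl
  have hpoly : IsHilbertPolynomial I (binomialPolynomial d e) := by
    refine Filter.Eventually.of_forall fun n => ⟨?_, ?_⟩
    · rw [hpow]
      exact ENat.natCast_ne_top _
    · rw [hH, eval_binomialPolynomial hd1, Int.toNat_natCast]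
  have he₀ : e₀ d I = e := by
    rw [e₀, hpoly.hilbertPolynomial_eq, factorial_mul_coeff_binomialPolynomial]
  have hzero : ∀ N : ℕ, N = 0 → (simplex d N).card = 0 := by
    rintro _ rfl
    rw [Finset.card_eq_zero, Finset.eq_empty_iff_forall_notMem]
    simp
  refine ⟨⟨?_, ?_, fun n => ?_⟩, fun x hx s n => ?_, fun x y hx hy s n => ?_⟩
  · rwa [hpoly.hilbertPolynomial_eq]
  · rw [hpoly.hilbertPolynomial_eq, natDegree_binomialPolynomial d he0]
  · rw [hpow]
    exact ENat.natCast_ne_top _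
  · have hF : F x s n = bracketCount d s n * e := by
      rw [F, hbr x hx, ENat.toNat_natCast]
      push_cast
      rfl
    have hsum : (bracketCount d s n : ℚ) = ∑ m ∈ Finset.Icc 1 d,
        (-1 : ℚ) ^ (m + 1) * (d.choose m : ℚ) * ((simplex d (s + n - m * s)).card : ℚ) := by
      exact_mod_cast congrArg (Int.cast : ℤ → ℚ) (bracketCount_eq_sum d s n)
    refine ⟨?_, fun h1 h2 => ?_, fun h1 h2 => ?_, fun h => ?_⟩
    · rw [hbr x hx]
      exact ENat.natCast_ne_top _
    -- For `n ≤ s` and `m ≥ 2` the simplex has size `s + n - m * s = 0`, so only `m = 1` survives.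
    · rw [hF, hH, Int.toNat_natCast, hsum, Finset.sum_eq_single 1]
      · simp only [Nat.choose_one_right, one_mul, Nat.add_sub_cancel_left]
        ring
      · intro m hm hm1
        have hm2 : 2 ≤ m := by
          have := (Finset.mem_Icc.mp hm).1
          omega
        have : s + n ≤ m * s := by nlinarith
        rw [hzero _ (by omega)]
        simp
      · intro h
        exact absurd (Finset.mem_Icc.mpr ⟨le_rfl, hd1⟩) h
    -- This kills the term `m = d`, which is why the sum stops at `d - 1`.
    · have hlast : s + n ≤ d * s := by
        zify
        linarith
      obtain ⟨k, rfl⟩ := Nat.exists_eq_add_of_le' hd1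
      rw [hF, hsum, Finset.sum_Icc_succ_top (by omega), hzero _ (by omega), Nat.add_sub_cancel,
        Nat.cast_zero, mul_zero, add_zero, Finset.sum_mul]
      refine Finset.sum_congr rfl fun m hm => ?_
      -- The convention `I ^ n = R` for `n ≤ 0` matches truncated subtraction in the count.
      have : ((n : ℤ) - ((m : ℤ) - 1) * s).toNat = s + n - m * s := by
        rw [← Int.toNat_sub]
        congr 1
        push_cast
        ring
      rw [hH, this]
      ring
    · have hcount := bracketCount_of_le (s := s) (n := n) hd1 (by
        zify [hd1]
        exact h)
      have hcount' : (bracketCount d s n : ℚ) + (s : ℚ) ^ d = (simplex d (s + n)).card := by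
        exact_mod_cast hcount
      have : ((n : ℤ) + s).toNat = s + n := by omega
      rw [hF, hH, he₀, this, ← hcount']
      ring
  · rw [hbr x hx, hbr y hy]
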